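/- **Conventions.** Let $P$ be a finite bounded graded poset of rank $n$, with least element $\hat 0$, greatest element $\hat 1$ and rank function $\operatorname{rk}$; write $s\lessdot t$ if $t$ covers $s$. An edge labeling $\lambda$ assigns to every cover relation $s\lessdot t$ an element $\lambda(s,t)$ of a totally ordered set. It is an *EL-labeling* if for all $s\le t$ the interval $[s,t]$ has a unique maximal chain with weakly increasing labels (read from $s$ to $t$), and the label word of this chain is lexicographically minimal among those of all maximal chains of $[s,t]$. For $s\in P$ let $\lambda_1<\cdots<\lambda_\ell$ be the distinct labels of the cover relations above $s$. For $s\lessdot t$ let $\mathrm{Ind}(s,t)$ be the index $i$ with $\lambda(s,t)=\lambda_i$; let $\omega_s(i)$ be the number of $t\gtrdot s$ with $\mathrm{Ind}(s,t)=i$; and let $\mathrm{des}_s(t)$ be the number of distinct labels of cover relations above $t$ that are strictly smaller than $\lambda(s,t)$. The poset $P$ is *UMEL-shellable* if it admits an EL-labeling such that 1. $\omega_s(i)=\omega_{s'}(i)$ for all $i\ge 1$ whenever $\operatorname{rk}s=\operatorname{rk}s'$; 2. $\mathrm{des}_s(t)=\mathrm{des}_{s'}(t')$ whenever $\operatorname{rk}s=\operatorname{rk}s'$,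 $s\lessdot t$, $s'\lessdot t'$ and $\mathrm{Ind}(s,t)=\mathrm{Ind}(s',t')$; 3. $\mathrm{des}_s(t)\le \mathrm{des}_s(t')$ whenever $s\lessdot t$, $s\lessdot t'$ and $\mathrm{Ind}(s,t)\le \mathrm{Ind}(s,t')$. The *$h$-polynomial* of $P$ is the $h$-polynomial of its order complex, $h_P(y)=\sum_{i=0}^{d} f_i\,y^i(1-y)^{d-i}$, where $f_i$ is the number of chains of $P$ with $i$ elements and $d=n+1$. For $s<t$ let $\overline\chi_{s,t}(x)=\frac{1}{x-1}\sum_{s\le u\le t}\mu(s,u)\,x^{\operatorname{rk}t-\operatorname{rk}u}$ be the reduced characteristic polynomial of $[s,t]$, where $\mu$ is the Möbius function. The *Chow polynomials* $\underline{\mathrm H}_{s,\hat 1}(x)$ of the intervals $[s,\hat 1]$ are defined recursively by $\underline{\mathrm H}_{\hat 1,\hat 1}=1$ and $$\underline{\mathrm H}_{s,\hat 1}(x)=\sum_{s<u\le \hat 1}\overline\chi_{s,u}(x)\,\underline{\mathrm H}_{u,\hat 1}(x)\qquad(s<\hat 1).$$ The Chow polynomial of $P$ is $\underline{\mathrm H}_P=\underline{\mathrm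 H}_{\hat 0,\hat 1}$, and its *augmented Chow polynomial* is $\mathrm H_P(x)=\sum_{s\in P}x^{\operatorname{rk}s}\,\underline{\mathrm H}_{s,\hat 1}(x)$. A polynomial is *real-rooted* if all its complex roots are real. **Corollary.** Let $P$ be a UMEL-shellable poset, and let $P^*$ be its dual, obtained by reversing the order. Then the $h$-polynomial $h_{P^*}$, the Chow polynomial $\underline{\mathrm H}_{P^*}$ and the augmented Chow polynomial $\mathrm H_{P^*}$ of $P^*$ are real-rooted. -/

import Mathlib

open Polynomial

universe u v

namespace UMEL

section Posets

/-- The rank of an element: the maximal length of a strict chain ending at it. -/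
noncomputable def rk {P : Type*} [PartialOrder P] (s : P) : ℕ :=
  (Order.height s).toNat

/-- A finite bounded poset is graded if the rank goes up by exactly one along every cover
relation; equivalently, all its maximal chains have the same length. -/
def IsGraded (P : Type*) [PartialOrder P] : Prop :=
  ∀ s t : P, s ⋖ t → rk t = rk s + 1

/-- `l` lists, in increasing order, the elements of a saturated chain
`s = u₀ ⋖ u₁ ⋖ ⋯ ⋖ u_k = t`, that is, of a maximal chain of the interval `[s, t]`. -/
def IsSaturatedChain {P : Type*} [PartialOrder P] (s t : P) (l : List P) : Prop :=
  l.IsChain (· ⋖ ·) ∧ l.head? = some s ∧ l.getLast? = some t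

end Posets

section EdgeLabelings

/-!
An edge labeling of `P` with labels in `Λ` is given as a function `lab : P → P → Λ`;
only the values `lab s t` with `s ⋖ t` are ever used.
-/

/-- The word of labels `lab u₀ u₁, lab u₁ u₂, …, lab u_{k-1} u_k` of the chain
`[u₀, u₁, …, u_k]`. -/
def chainLabels {P Λ : Type*} (lab : P → P → Λ) : List P → List Λ
  | [] => []
  | [_] => []
  | a :: b :: l => lab a b :: chainLabels lab (b :: l)

/-- Edge-lexicographical labelings: every interval `[s, t]` has exactly one maximal chain with
weakly increasing labels, and its word of labels is lexicographically minimal among those of the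
maximal chains of `[s, t]`. -/
def IsELLabeling {P Λ : Type*} [PartialOrder P] [LinearOrder Λ] (lab : P → P → Λ) : Prop :=
  ∀ s t : P, s ≤ t → ∃ l : List P,
    IsSaturatedChain s t l ∧
    (chainLabels lab l).IsChain (· ≤ ·) ∧
    (∀ l' : List P, IsSaturatedChain s t l' → (chainLabels lab l').IsChain (· ≤ ·) → l' = l) ∧
    (∀ l' : List P, IsSaturatedChain s t l' → chainLabels lab l ≤ chainLabels lab l')

open Classical in
/-- The set of labels of the covering relations above `s`. -/
noncomputable def labelsAbove {P Λ : Type*} [PartialOrder P] [Fintype P]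
    (lab : P → P → Λ) (s : P) : Finset Λ :=
  (Finset.univ.filter fun t : P => s ⋖ t).image (lab s)

open Classical in
/-- `Ind(s, t)`: the position of the label of `s ⋖ t`, counted from `1`, in the increasing
enumeration `λ₁ < ⋯ < λ_ℓ` of the labels above `s`. -/
noncomputable def ind {P Λ : Type*} [PartialOrder P] [Fintype P] [LinearOrder Λ]
    (lab : P → P → Λ) (s t : P) : ℕ :=
  ((labelsAbove lab s).filter fun m => m ≤ lab s t).card

open Classical in
/-- The width above `s` at index `i`: the number of covers of `s` with label `λ_i`. -/
noncomputable def width {P Λ : Type*} [PartialOrder P] [Fintype P] [LinearOrder Λ]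
    (lab : P → P → Λ) (s : P) (i : ℕ) : ℕ :=
  (Finset.univ.filter fun t : P => s ⋖ t ∧ ind lab s t = i).card

open Classical in
/-- `des_s(t)`: the number of distinct labels above `t` that are smaller than the label of
`s ⋖ t`. -/
noncomputable def desCount {P Λ : Type*} [PartialOrder P] [Fintype P] [LinearOrder Λ]
    (lab : P → P → Λ) (s t : P) : ℕ :=
  ((labelsAbove lab t).filter fun m => m < lab s t).card

/-- Rank-uniformity of a labeled poset: uniform widths and uniform descents. -/
def IsRankUniform {P Λ : Type*} [PartialOrder P] [Fintype P] [LinearOrder Λ]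
    (lab : P → P → Λ) : Prop :=
  (∀ s s' : P, rk s = rk s' → ∀ i : ℕ, 1 ≤ i → width lab s i = width lab s' i) ∧
  (∀ s t s' t' : P, rk s = rk s' → s ⋖ t → s' ⋖ t' → ind lab s t = ind lab s' t' →
    desCount lab s t = desCount lab s' t')

/-- Monotonicity of a (rank-uniform) labeled poset: above each element, the descent count is a
weakly increasing function of the index of the label. -/
def IsMonotonic {P Λ : Type*} [PartialOrder P] [Fintype P] [LinearOrder Λ]
    (lab : P → P → Λ) : Prop :=
  ∀ s t t' : P, s ⋖ t → s ⋖ t' → ind lab s t ≤ ind lab s t' →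
    desCount lab s t ≤ desCount lab s t'

/-- UMEL-shellable posets: finite bounded graded posets that admit, with labels in some totally
ordered set, an EL-labeling which is rank-uniform and monotonic. -/
def IsUMELShellable (P : Type u) [PartialOrder P] [BoundedOrder P] [Fintype P] : Prop :=
  IsGraded P ∧ ∃ (Λ : Type v) (_ : LinearOrder Λ) (lab : P → P → Λ),
    IsELLabeling lab ∧ IsRankUniform lab ∧ IsMonotonic lab

end EdgeLabelings

section OrderComplex

open Classical in
/-- The faces of the order complex `Δ(P)`: the chains of `P`, including the empty chain. -/
noncomputable def orderComplexFaces (P : Type*) [PartialOrder P] [Fintype P] :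
    Finset (Finset P) :=
  Finset.univ.filter fun c : Finset P => IsChain (· ≤ ·) (c : Set P)

/-- The `h`-polynomial `∑ᵢ fᵢ yⁱ (1 - y)^(d - i)` of the finite simplicial complex of dimension
`d - 1` with the given faces, where `fᵢ` is the number of faces with `i` elements. -/
noncomputable def hPolyOfFaces {V : Type*} (F : Finset (Finset V)) : ℤ[X] :=
  ∑ i ∈ Finset.range (F.sup Finset.card + 1),
    C (((F.filter fun c => c.card = i).card : ℕ) : ℤ) * X ^ i *
      (1 - X) ^ (F.sup Finset.card - i)

/-- The `h`-polynomial of the order complex of `P`. -/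
noncomputable def hPoly (P : Type*) [PartialOrder P] [Fintype P] : ℤ[X] :=
  hPolyOfFaces (orderComplexFaces P)

end OrderComplex

section Chow

variable {P : Type*} [PartialOrder P] [LocallyFiniteOrder P] [DecidableEq P]

/-- The characteristic polynomial of the interval `[s, t]` of a graded poset:
`∑_{s ≤ u ≤ t} μ(s, u) x^(rk t - rk u)`. -/
noncomputable def charPoly (s t : P) : ℤ[X] :=
  ∑ u ∈ Finset.Icc s t, C (IncidenceAlgebra.mu ℤ s u) * X ^ (rk t - rk u)

/-- The reduced characteristic polynomial of `[s, t]` for `s < t`: the (exact) quotient of the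
characteristic polynomial by `x - 1`. -/
noncomputable def redCharPoly (s t : P) : ℤ[X] :=
  charPoly s t /ₘ (X - 1)

/-- The Chow polynomial of the interval `[s, ⊤]`: it is `1` if `s = ⊤`, and otherwise
`∑_{s < u ≤ ⊤}` of the reduced characteristic polynomial of `[s, u]` times the Chow polynomial of
`[u, ⊤]`. -/
noncomputable def chowAbove [OrderTop P] (s : P) : ℤ[X] :=
  if s = ⊤ then 1
  else ∑ u ∈ (Finset.Ioc s ⊤).attach, redCharPoly s u.1 * chowAbove u.1
termination_by (Finset.Ioc s ⊤).card
decreasing_by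
  apply Finset.card_lt_card
  have h := Finset.mem_Ioc.mp u.2
  refine Finset.ssubset_iff_of_subset (fun x hx => ?_) |>.mpr ⟨u.1, u.2, by simp⟩
  rw [Finset.mem_Ioc] at hx ⊢
  exact ⟨h.1.trans hx.1, hx.2⟩

theorem chowAbove_eq [OrderTop P] (s : P) :
    chowAbove s = if s = ⊤ then 1
      else ∑ u ∈ Finset.Ioc s ⊤, redCharPoly s u * chowAbove u := by
  rw [chowAbove, Finset.sum_attach (Finset.Ioc s ⊤) fun u => redCharPoly s u * chowAbove u]

variable (P) [BoundedOrder P]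

/-- The Chow polynomial of a finite bounded graded poset. -/
noncomputable def chowPoly : ℤ[X] :=
  chowAbove (⊥ : P)

/-- The augmented Chow polynomial `∑_s x^(rk s) H_{[s, ⊤]}(x)` of a finite bounded graded poset,
where `H` is the Chow polynomial. -/
noncomputable def augChowPoly : ℤ[X] :=
  ∑ s ∈ Finset.Icc (⊥ : P) ⊤, X ^ rk s * chowAbove s

end Chow

/-- A polynomial is real-rooted if all its complex roots are real. -/
def RealRooted (p : ℤ[X]) : Prop :=
  ∀ z : ℂ, aeval z p = 0 → z.im = 0

end UMEL

/-! Suppose a nonreal number were a root. Everything is then done at that one complex value: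
interlacing of polynomials is replaced by the pointwise relation `Interlaces v f g`, which is
additive in each argument and passes from the pair f, g to the pair g, v f. If v avoids (-∞, 0], a
sum with a nonzero term that interlaces all its terms cannot vanish (`Interlaces.sum_ne_zero`).

Up to nonzero factors, each value to be shown nonzero is a sum over saturated chains from ⊥ to ⊤,
weighted by descents (`pathWeight`); the one-element poset is treated apart. By rank-uniformity the
weight of an edge depends only on rank and index. By monotonicity the threshold between descents and
ascents rises with the index, so interlacing survives each lengthening of the chains
(`pathWeight_interlaces`). An edge with the smallest label is followed by no descent, so its weight
is a nonzero multiple of a shorter sum, and induction gives `IsGraded.sum_pathWeight_ne_zero`.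

The EL-property links this to the poset: sorting the elements u > s by the first step of the
increasing chain of [s, u] turns sums over u into recursions along ascents (`stepSum_eq`). For h,
duality does not change the chains, and v is the root itself. For the Chow polynomials, v =
z/(1+z)^2 and double descents are excluded, as in a gamma-expansion. Path sums define weights A on P
(`exists_chow_weights`), and pairing A with the Chow recursion of the dual identifies the total
weight with the value of either polynomial (`IsGraded.sum_chow_weights`). -/

namespace UMEL

open scoped ComplexConjugate

/-! ### Interlacing at a complex point. -/

section Interlacing

/-- The complex values `f` and `g` interlace at `v` if `g * conj f` lies in the convex cone
spanned by `1` and `v`. -/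
def Interlaces (v f g : ℂ) : Prop :=
  ∃ a b : ℝ, 0 ≤ a ∧ 0 ≤ b ∧ g * conj f = a + b * v

namespace Interlaces

variable {v f f₁ f₂ g g₁ g₂ : ℂ}

theorem refl (v f : ℂ) : Interlaces v f f :=
  ⟨Complex.normSq f, 0, Complex.normSq_nonneg f, le_rfl, by simp [Complex.mul_conj]⟩

theorem zero_left (v g : ℂ) : Interlaces v 0 g := ⟨0, 0, le_rfl, le_rfl, by simp⟩

theorem zero_right (v f : ℂ) : Interlaces v f 0 := ⟨0, 0, le_rfl, le_rfl, by simp⟩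

theorem add_right (h₁ : Interlaces v f g₁) (h₂ : Interlaces v f g₂) :
    Interlaces v f (g₁ + g₂) := by
  obtain ⟨a, b, ha, hb, h⟩ := h₁
  obtain ⟨c, d, hc, hd, h'⟩ := h₂
  refine ⟨a + c, b + d, by positivity, by positivity, ?_⟩
  rw [add_mul, h, h']
  push_cast
  ring

theorem add_left (h₁ : Interlaces v f₁ g) (h₂ : Interlaces v f₂ g) :
    Interlaces v (f₁ + f₂) g := by
  obtain ⟨a, b, ha, hb, h⟩ := h₁
  obtain ⟨c, d, hc, hd, h'⟩ := h₂
  refine ⟨a + c, b + d, by positivity, by positivity, ?_⟩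
  rw [map_add, mul_add, h, h']
  push_cast
  ring

theorem sum_right {ι : Type*} {s : Finset ι} {g : ι → ℂ} (h : ∀ i ∈ s, Interlaces v f (g i)) :
    Interlaces v f (∑ i ∈ s, g i) :=
  Finset.sum_induction g (Interlaces v f) (fun _ _ => add_right) (zero_right v f) h

theorem sum_left {ι : Type*} {s : Finset ι} {f : ι → ℂ} (h : ∀ i ∈ s, Interlaces v (f i) g) :
    Interlaces v (∑ i ∈ s, f i) g :=
  Finset.sum_induction f (Interlaces v · g) (fun _ _ => add_left) (zero_left v g) h

theorem sum_sum {ι κ : Type*} {s : Finset ι} {t : Finset κ} {f : ι → ℂ} {g : κ → ℂ}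
    (h : ∀ i ∈ s, ∀ j ∈ t, Interlaces v (f i) (g j)) :
    Interlaces v (∑ i ∈ s, f i) (∑ j ∈ t, g j) :=
  sum_left fun i hi => sum_right (h i hi)

theorem mul_mul (κ : ℂ) (h : Interlaces v f g) : Interlaces v (κ * f) (κ * g) := by
  obtain ⟨a, b, ha, hb, h⟩ := h
  have hκ := Complex.normSq_nonneg κ
  refine ⟨Complex.normSq κ * a, Complex.normSq κ * b, by positivity, by positivity, ?_⟩
  calc κ * g * conj (κ * f) = (κ * conj κ) * (g * conj f) := by rw [map_mul]; ring
    _ = _ := by rw [h, Complex.mul_conj]; push_cast; ring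

/-- Conjugating a + b v and multiplying by v gives a v + b |v|^2, which lies in the same cone. -/
theorem rotate (h : Interlaces v f g) : Interlaces v g (v * f) := by
  obtain ⟨a, b, ha, hb, h⟩ := h
  have hv := Complex.normSq_nonneg v
  refine ⟨b * Complex.normSq v, a, by positivity, ha, ?_⟩
  calc v * f * conj g = v * conj (g * conj f) := by simp; ring
    _ = a * v + b * (v * conj v) := by rw [h]; simp; ring
    _ = _ := by rw [Complex.mul_conj]; push_cast; ring

/-- If `v` is not in `(-∞, 0]`, then a sum of values interlaced by one of its nonzero terms does
not vanish. -/
theorem sum_ne_zero {ι : Type*} {s : Finset ι} {g : ι → ℂ} (hv : ∀ r : ℝ, r ≤ 0 → v ≠ r)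
    {i : ι} (hi : i ∈ s) (hgi : g i ≠ 0) (h : ∀ j ∈ s, Interlaces v (g i) (g j)) :
    ∑ j ∈ s, g j ≠ 0 := by
  classical
  intro h0
  rw [← Finset.add_sum_erase s g hi] at h0
  obtain ⟨a, b, ha, hb, hab⟩ : Interlaces v (g i) (∑ j ∈ s.erase i, g j) :=
    sum_right fun j hj => h j (Finset.mem_of_mem_erase hj)
  have hpos := Complex.normSq_pos.mpr hgi
  have key : ((Complex.normSq (g i) + a : ℝ) : ℂ) + b * v = 0 := by
    calc _ = g i * conj (g i) + (a + b * v) := by rw [Complex.mul_conj]; push_cast; ring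
      _ = (g i + ∑ j ∈ s.erase i, g j) * conj (g i) := by rw [← hab]; ring
      _ = 0 := by rw [h0, zero_mul]
  rcases hb.eq_or_lt with rfl | hb
  · simp only [Complex.ofReal_zero, zero_mul, add_zero, Complex.ofReal_eq_zero] at key
    linarith
  · refine hv (-(Complex.normSq (g i) + a) / b)
      (div_nonpos_of_nonpos_of_nonneg (by linarith) hb.le) ?_
    have hb' : (b : ℂ) ≠ 0 := by exact_mod_cast hb.ne'
    push_cast at key ⊢
    field_simp
    linear_combination key

end Interlaces

section Step

variable {ι : Type*} {U : Finset ι} {k : ι → ℕ} {v : ℂ} {g e : ι → ℂ}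

/-- One step of the chain recursion: d and d' play the role of descent counts, k that of the index.
Interlacing is not transitive, so every claim is assembled by additivity from the three blocks cut
out by d and d'. -/
theorem interlaces_threshold_sums
    (hee : ∀ i ∈ U, ∀ j ∈ U, k i ≤ k j → Interlaces v (e i) (e j))
    (hgg : ∀ i ∈ U, ∀ j ∈ U, k i ≤ k j → Interlaces v (g i) (g j))
    (heg : ∀ i ∈ U, ∀ j ∈ U, Interlaces v (e i) (g j - e j)) {d d' : ℕ} (hd : d ≤ d') :
    Interlaces v (∑ i ∈ U with d < k i, g i) (∑ i ∈ U with d' < k i, g i) ∧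
    Interlaces v (∑ i ∈ U with d < k i, g i + v * ∑ i ∈ U with k i ≤ d, e i)
      (∑ i ∈ U with d' < k i, g i + v * ∑ i ∈ U with k i ≤ d', e i) ∧
    Interlaces v (∑ i ∈ U with d < k i, g i) (v * ∑ i ∈ U with k i ≤ d', e i) ∧
    Interlaces v (∑ i ∈ U with d' < k i, g i) (v * ∑ i ∈ U with k i ≤ d, e i) := by
  classical
  set A := U.filter fun i => k i ≤ d with hA
  set B := U.filter fun i => d < k i ∧ k i ≤ d' with hB
  set C := U.filter fun i => d' < k i with hC
  have hBC : ∀ f : ι → ℂ, ∑ i ∈ U with d < k i, f i = ∑ i ∈ B, f i + ∑ i ∈ C, f i := by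
    intro f
    rw [← Finset.sum_union]
    · congr 1
      ext i
      simp only [hB, hC, Finset.mem_filter, Finset.mem_union]
      grind
    · rw [Finset.disjoint_left]
      simp only [hB, hC, Finset.mem_filter]
      grind
  have hAB : ∀ f : ι → ℂ, ∑ i ∈ U with k i ≤ d', f i = ∑ i ∈ A, f i + ∑ i ∈ B, f i := by
    intro f
    rw [← Finset.sum_union]
    · congr 1
      ext i
      simp only [hA, hB, Finset.mem_filter, Finset.mem_union]
      grind
    · rw [Finset.disjoint_left]
      simp only [hA, hB, Finset.mem_filter]
      grind
  have heg' : ∀ i ∈ U, ∀ j ∈ U, k i ≤ k j → Interlaces v (e i) (g j) := fun i hi j hj hij => by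
    simpa using (hee i hi j hj hij).add_right (heg i hi j hj)
  have hAB' : Interlaces v (∑ i ∈ A, e i) (∑ i ∈ B, g i) := Interlaces.sum_sum fun i hi j hj => by
    simp only [hA, hB, Finset.mem_filter] at hi hj
    exact heg' i hi.1 j hj.1 (by omega)
  have hABe : Interlaces v (∑ i ∈ A, e i) (∑ i ∈ B, e i) := Interlaces.sum_sum fun i hi j hj => by
    simp only [hA, hB, Finset.mem_filter] at hi hj
    exact hee i hi.1 j hj.1 (by omega)
  have hAC : Interlaces v (∑ i ∈ A, e i) (∑ i ∈ C, g i) := Interlaces.sum_sum fun i hi j hj => by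
    simp only [hA, hC, Finset.mem_filter] at hi hj
    exact heg' i hi.1 j hj.1 (by omega)
  have hBCe : Interlaces v (∑ i ∈ B, e i) (∑ i ∈ C, g i) := Interlaces.sum_sum fun i hi j hj => by
    simp only [hB, hC, Finset.mem_filter] at hi hj
    exact heg' i hi.1 j hj.1 (by omega)
  have hBCg : Interlaces v (∑ i ∈ B, g i) (∑ i ∈ C, g i) := Interlaces.sum_sum fun i hi j hj => by
    simp only [hB, hC, Finset.mem_filter] at hi hj
    exact hgg i hi.1 j hj.1 (by omega)
  -- Within one block the indices are not ordered, so the argument writes g = e + (g - e) and uses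
  -- `heg`, which needs no comparison of indices.
  have hBB : Interlaces v (∑ i ∈ B, e i) (∑ i ∈ B, g i) := by
    have := (Interlaces.refl v (∑ i ∈ B, e i)).add_right
      (Interlaces.sum_sum (s := B) (t := B) fun i hi j hj =>
        heg i (Finset.mem_filter.mp hi).1 j (Finset.mem_filter.mp hj).1)
    simpa [Finset.sum_sub_distrib] using this
  rw [hBC g, hAB e]
  refine ⟨hBCg.add_left (.refl _ _), ?_, ?_, hAC.rotate⟩
  · rw [show ∑ i ∈ B, g i + ∑ i ∈ C, g i + v * ∑ i ∈ A, e i =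
        ∑ i ∈ B, g i + (∑ i ∈ C, g i + v * ∑ i ∈ A, e i) by ring,
      show ∑ i ∈ C, g i + v * (∑ i ∈ A, e i + ∑ i ∈ B, e i) =
        (∑ i ∈ C, g i + v * ∑ i ∈ A, e i) + v * ∑ i ∈ B, e i by ring]
    exact ((hBCg.add_right hAB'.rotate).add_right hBB.rotate).add_left
      ((Interlaces.refl _ _).add_right (hBCe.rotate.add_left (hABe.mul_mul v)))
  · rw [mul_add]
    exact (hAB'.rotate.add_left hAC.rotate).add_right (hBB.rotate.add_left hBCe.rotate)

end Step

end Interlacing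

/-! ### Indices, descent counts and rank-uniformity. -/

section Labels

variable {P : Type u} [PartialOrder P] [Fintype P] {Λ : Type v}

open Classical in
/-- The elements covering `s`. -/
noncomputable def coversAbove (s : P) : Finset P := Finset.univ.filter (s ⋖ ·)

theorem mem_coversAbove {s t : P} : t ∈ coversAbove s ↔ s ⋖ t := by simp [coversAbove]

theorem mem_labelsAbove {lab : P → P → Λ} {s t : P} (h : s ⋖ t) :
    lab s t ∈ labelsAbove lab s := by
  classical
  simp only [labelsAbove, Finset.mem_image, Finset.mem_filter, Finset.mem_univ, true_and]
  exact ⟨t, h, rfl⟩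

theorem card_labelsAbove_le (lab : P → P → Λ) (s : P) :
    (labelsAbove lab s).card ≤ Fintype.card P := by
  classical
  exact Finset.card_image_le.trans (Finset.card_le_univ _)

variable [LinearOrder Λ]

theorem one_le_ind {lab : P → P → Λ} {s t : P} (h : s ⋖ t) : 1 ≤ ind lab s t := by
  classical
  rw [ind, Nat.one_le_iff_ne_zero, Finset.card_ne_zero]
  exact ⟨lab s t, Finset.mem_filter.mpr ⟨mem_labelsAbove h, le_rfl⟩⟩

theorem ind_le_ind {lab : P → P → Λ} {s t t' : P} (h : lab s t ≤ lab s t') :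
    ind lab s t ≤ ind lab s t' := by
  classical
  exact Finset.card_le_card fun m hm => by
    rw [Finset.mem_filter] at hm ⊢
    exact ⟨hm.1, hm.2.trans h⟩

/-- Both sides count labels above t, below `lab s t` strictly and up to `lab t u` weakly. Hence
ascents and descents are separated by a threshold on the index. -/
theorem desCount_lt_ind_iff {lab : P → P → Λ} {s t u : P} (h : t ⋖ u) :
    desCount lab s t < ind lab t u ↔ lab s t ≤ lab t u := by
  classical
  constructor
  · intro hlt
    by_contra! hlab
    refine absurd hlt (not_lt.mpr (Finset.card_le_card fun m hm => ?_))
    rw [Finset.mem_filter] at hm ⊢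
    exact ⟨hm.1, hm.2.trans_lt hlab⟩
  · intro hlab
    refine Finset.card_lt_card ((Finset.ssubset_iff_of_subset fun m hm => ?_).mpr
      ⟨lab t u, Finset.mem_filter.mpr ⟨mem_labelsAbove h, le_rfl⟩, ?_⟩)
    · rw [Finset.mem_filter] at hm ⊢
      exact ⟨hm.1, hm.2.le.trans hlab⟩
    · rw [Finset.mem_filter]
      exact fun hm => absurd hm.2 (not_lt.mpr hlab)

theorem ind_le_desCount_iff {lab : P → P → Λ} {s t u : P} (h : t ⋖ u) :
    ind lab t u ≤ desCount lab s t ↔ lab t u < lab s t := by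
  rw [← not_lt, desCount_lt_ind_iff h, not_le]

theorem width_eq_card {lab : P → P → Λ} (s : P) (i : ℕ) :
    width lab s i = ((coversAbove s).filter fun t => ind lab s t = i).card := by
  classical
  rw [width, coversAbove, Finset.filter_filter]

theorem IsRankUniform.desCount_le {lab : P → P → Λ} (hU : IsRankUniform lab)
    (hM : IsMonotonic lab) {s t s' t' : P} (hs : rk s = rk s') (h : s ⋖ t) (h' : s' ⋖ t')
    (hi : ind lab s t ≤ ind lab s' t') : desCount lab s t ≤ desCount lab s' t' := by
  -- Equal widths supply a cover of s with the index of t', which brings the comparison back to one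
  -- element, where monotonicity applies.
  obtain ⟨x, hx⟩ : ((coversAbove s).filter fun x => ind lab s x = ind lab s' t').Nonempty := by
    rw [← Finset.card_pos, ← width_eq_card, hU.1 s s' hs _ (one_le_ind h'), width_eq_card,
      Finset.card_pos]
    exact ⟨t', Finset.mem_filter.mpr ⟨mem_coversAbove.mpr h', rfl⟩⟩
  rw [Finset.mem_filter, mem_coversAbove] at hx
  rw [← hU.2 s x s' t' hs hx.1 h' hx.2]
  exact hM s t x h hx.1 (hi.trans_eq hx.2.symm)

/-- In a rank-uniform poset, sums over the covers of an element of a function that depends only on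
the index depend only on the rank of that element. -/
theorem IsRankUniform.sum_covers_eq {lab : P → P → Λ} (hU : IsRankUniform lab) {t t' : P}
    (ht : rk t = rk t') {F : P → P → ℂ}
    (hF : ∀ u u', t ⋖ u → t' ⋖ u' → ind lab t u = ind lab t' u' → F t u = F t' u')
    (p : ℕ → Prop) [DecidablePred p] :
    ∑ u ∈ coversAbove t with p (ind lab t u), F t u =
      ∑ u ∈ coversAbove t' with p (ind lab t' u), F t' u := by
  classical
  have hcard : ∀ i, ((coversAbove t).filter fun u => ind lab t u = i).card =
      ((coversAbove t').filter fun u => ind lab t' u = i).card := by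
    intro i
    rcases Nat.eq_zero_or_pos i with rfl | hi
    · have h0 : ∀ x : P, ((coversAbove x).filter fun u => ind lab x u = 0) = ∅ := fun x =>
        Finset.filter_eq_empty_iff.mpr fun u hu h => by
          have := one_le_ind (lab := lab) (mem_coversAbove.mp hu)
          omega
      rw [h0, h0]
    · rw [← width_eq_card, ← width_eq_card, hU.1 t t' ht i hi]
  have hind : ∀ x u : P, x ⋖ u → ind lab x u ∈ Finset.range (Fintype.card P + 1) := by
    intro x u _
    rw [Finset.mem_range, Nat.lt_succ_iff]
    exact (Finset.card_filter_le _ _).trans (card_labelsAbove_le lab x)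
  have hfib : ∀ x : P, ∑ u ∈ coversAbove x with p (ind lab x u), F x u =
      ∑ i ∈ (Finset.range (Fintype.card P + 1)).filter p,
        ∑ u ∈ coversAbove x with ind lab x u = i, F x u := by
    intro x
    rw [← Finset.sum_fiberwise_of_maps_to (g := ind lab x)
      (t := (Finset.range (Fintype.card P + 1)).filter p)]
    · refine Finset.sum_congr rfl fun i hi => Finset.sum_congr ?_ fun _ _ => rfl
      ext u
      simp only [Finset.mem_filter] at hi ⊢
      grind
    · intro u hu
      rw [Finset.mem_filter, mem_coversAbove] at hu
      exact Finset.mem_filter.mpr ⟨hind x u hu.1, hu.2⟩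
  rw [hfib t, hfib t']
  refine Finset.sum_congr rfl fun i _ => ?_
  refine Finset.sum_bij' (fun u hu => (Finset.equivOfCardEq (hcard i) ⟨u, hu⟩).1)
    (fun u hu => ((Finset.equivOfCardEq (hcard i)).symm ⟨u, hu⟩).1)
    (fun u hu => Subtype.prop _) (fun u hu => Subtype.prop _) (by simp) (by simp) ?_
  intro u hu
  have hu' := (Finset.equivOfCardEq (hcard i) ⟨u, hu⟩).2
  rw [Finset.mem_filter, mem_coversAbove] at hu hu'
  exact hF _ _ hu.1 hu'.1 (hu.2.trans hu'.2.symm)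

end Labels

/-! ### Descent-weighted sums over saturated chains. -/

section PathWeights

variable {P : Type u} [PartialOrder P] [Fintype P] {Λ : Type v} [LinearOrder Λ]

open Classical in
/-- The sum of `F t u` over the covers `u` of `t` such that `s ⋖ t ⋖ u` is an ascent. -/
noncomputable def ascSum (lab : P → P → Λ) (F : P → P → ℂ) (s t : P) : ℂ :=
  ∑ u ∈ coversAbove t with lab s t ≤ lab t u, F t u

open Classical in
/-- The sum of `F t u` over the covers `u` of `t` such that `s ⋖ t ⋖ u` is a descent. -/
noncomputable def desSum (lab : P → P → Λ) (F : P → P → ℂ) (s t : P) : ℂ :=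
  ∑ u ∈ coversAbove t with lab t u < lab s t, F t u

/-- Weighted sums over the saturated chains of length `m` that continue an edge `s ⋖ t`. The first
component allows all chains; the second one weights those that start with a descent by `τ`. Each
descent has weight `v`, and has to be followed by a chain counted by the second component. -/
noncomputable def pathWeight (lab : P → P → Λ) (τ v κ g₀ e₀ : ℂ) : ℕ → (P → P → ℂ × ℂ)
  | 0 => fun _ _ => (g₀, e₀)
  | m + 1 => fun s t =>
    let asc := ascSum lab (fun a b => (pathWeight lab τ v κ g₀ e₀ m a b).1) s t
    let des := desSum lab (fun a b => (pathWeight lab τ v κ g₀ e₀ m a b).2) s t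
    (κ * (asc + v * des), κ * (asc + τ * (v * des)))

theorem ascSum_add_desSum (lab : P → P → Λ) (F : P → P → ℂ) (s t : P) :
    ascSum lab F s t + desSum lab F s t = ∑ u ∈ coversAbove t, F t u := by
  classical
  rw [ascSum, desSum,
    ← Finset.sum_filter_add_sum_filter_not (coversAbove t) (fun u => lab s t ≤ lab t u)]
  simp only [not_le]

theorem ascSum_eq (lab : P → P → Λ) (F : P → P → ℂ) (s t : P) :
    ascSum lab F s t = ∑ u ∈ coversAbove t with desCount lab s t < ind lab t u, F t u := by
  classical
  refine Finset.sum_congr (Finset.filter_congr fun u hu => ?_) fun _ _ => rfl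
  exact (desCount_lt_ind_iff (mem_coversAbove.mp hu)).symm

theorem desSum_eq (lab : P → P → Λ) (F : P → P → ℂ) (s t : P) :
    desSum lab F s t = ∑ u ∈ coversAbove t with ind lab t u ≤ desCount lab s t, F t u := by
  classical
  refine Finset.sum_congr (Finset.filter_congr fun u hu => ?_) fun _ _ => rfl
  exact (ind_le_desCount_iff (mem_coversAbove.mp hu)).symm

/-- The three claims need one another in the induction: the first moves sums over covers of t' to
covers of t, and the other two are the hypotheses of `interlaces_threshold_sums`. -/
theorem pathWeight_interlaces {lab : P → P → Λ} (hG : IsGraded P) (hU : IsRankUniform lab)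
    (hM : IsMonotonic lab) {τ v κ g₀ e₀ : ℂ} (hτ : τ = 0 ∨ τ = 1)
    (h₀ : Interlaces v e₀ (g₀ - e₀)) (m : ℕ) :
    ∀ s t s' t' : P, rk s = rk s' → s ⋖ t → s' ⋖ t' →
      (ind lab s t = ind lab s' t' →
        pathWeight lab τ v κ g₀ e₀ m s t = pathWeight lab τ v κ g₀ e₀ m s' t') ∧
      (ind lab s t ≤ ind lab s' t' →
        Interlaces v (pathWeight lab τ v κ g₀ e₀ m s t).1
          (pathWeight lab τ v κ g₀ e₀ m s' t').1 ∧
        Interlaces v (pathWeight lab τ v κ g₀ e₀ m s t).2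
          (pathWeight lab τ v κ g₀ e₀ m s' t').2) ∧
      Interlaces v (pathWeight lab τ v κ g₀ e₀ m s t).2
        ((pathWeight lab τ v κ g₀ e₀ m s' t').1 - (pathWeight lab τ v κ g₀ e₀ m s' t').2) := by
  induction m with
  | zero =>
    intro s t s' t' _ _ _
    exact ⟨fun _ => rfl, fun _ => ⟨.refl _ _, .refl _ _⟩, h₀⟩
  | succ m ih =>
    intro s t s' t' hs h h'
    set G : P → P → ℂ := fun a b => (pathWeight lab τ v κ g₀ e₀ m a b).1 with hGdef
    set E : P → P → ℂ := fun a b => (pathWeight lab τ v κ g₀ e₀ m a b).2 with hEdef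
    have hrk : rk t = rk t' := by rw [hG s t h, hG s' t' h', hs]
    have hGt : ∀ u u', t ⋖ u → t' ⋖ u' → ind lab t u = ind lab t' u' → G t u = G t' u' :=
      fun u u' hu hu' hi => congrArg Prod.fst ((ih t u t' u' hrk hu hu').1 hi)
    have hEt : ∀ u u', t ⋖ u → t' ⋖ u' → ind lab t u = ind lab t' u' → E t u = E t' u' :=
      fun u u' hu hu' hi => congrArg Prod.snd ((ih t u t' u' hrk hu hu').1 hi)
    have hasc : ascSum lab G s' t' =
        ∑ u ∈ coversAbove t with desCount lab s' t' < ind lab t u, G t u := by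
      rw [ascSum_eq, ← hU.sum_covers_eq hrk hGt fun i => desCount lab s' t' < i]
    have hdes : desSum lab E s' t' =
        ∑ u ∈ coversAbove t with ind lab t u ≤ desCount lab s' t', E t u := by
      rw [desSum_eq, ← hU.sum_covers_eq hrk hEt fun i => i ≤ desCount lab s' t']
    have step := fun (d d' : ℕ) (hd : d ≤ d') =>
      interlaces_threshold_sums (U := coversAbove t) (k := ind lab t) (v := v) (g := G t)
        (e := E t)
        (fun i hi j hj hij => ((ih t i t j rfl (mem_coversAbove.mp hi)
          (mem_coversAbove.mp hj)).2.1 hij).2)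
        (fun i hi j hj hij => ((ih t i t j rfl (mem_coversAbove.mp hi)
          (mem_coversAbove.mp hj)).2.1 hij).1)
        (fun i hi j hj => (ih t i t j rfl (mem_coversAbove.mp hi)
          (mem_coversAbove.mp hj)).2.2) hd
    simp only [pathWeight, ← hGdef, ← hEdef]
    rw [hasc, hdes, ascSum_eq lab G s t, desSum_eq lab E s t]
    refine ⟨fun hi => ?_, fun hi => ?_, ?_⟩
    · rw [hU.2 s t s' t' hs h h' hi]
    · obtain ⟨h1, h2, -, -⟩ := step _ _ (hU.desCount_le hM hs h h' hi)
      refine ⟨h2.mul_mul κ, Interlaces.mul_mul κ ?_⟩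
      rcases hτ with rfl | rfl
      · simpa using h1
      · simpa using h2
    · rcases hτ with rfl | rfl
      -- For τ = 0 the difference of the components is the descent part alone, hence the two mixed
      -- claims of `step`, one for each order of the thresholds.
      · simp only [zero_mul, add_zero, ← mul_sub, add_sub_cancel_left]
        refine Interlaces.mul_mul κ ?_
        rcases le_total (desCount lab s t) (desCount lab s' t') with hd | hd
        · exact (step _ _ hd).2.2.1
        · exact (step _ _ hd).2.2.2
      · simpa using Interlaces.zero_right v _

end PathWeights

/-! ### First steps of increasing chains. -/

section FirstStep

variable {P : Type u} [PartialOrder P] {Λ : Type v} [LinearOrder Λ]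

theorem IsSaturatedChain.cons {s t u : P} {l : List P} (h : s ⋖ t)
    (hl : IsSaturatedChain t u (t :: l)) : IsSaturatedChain s u (s :: t :: l) := by
  obtain ⟨h1, -, h3⟩ := hl
  exact ⟨List.isChain_cons_cons.mpr ⟨h, h1⟩, rfl, by rwa [List.getLast?_cons_cons]⟩

theorem IsSaturatedChain.tail {s t u : P} {l : List P}
    (hl : IsSaturatedChain s u (s :: t :: l)) : s ⋖ t ∧ IsSaturatedChain t u (t :: l) := by
  obtain ⟨h1, -, h3⟩ := hl
  rw [List.isChain_cons_cons] at h1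
  exact ⟨h1.1, h1.2, rfl, by rwa [List.getLast?_cons_cons] at h3⟩

theorem IsSaturatedChain.le {u : P} {l : List P} :
    ∀ {s : P}, IsSaturatedChain s u (s :: l) → s ≤ u := by
  induction l with
  | nil =>
    intro s h
    have : s = u := by simpa using h.2.2
    exact this.le
  | cons t l ih => intro s h; exact h.tail.1.le.trans (ih h.tail.2)

theorem IsSaturatedChain.exists_eq_cons {s u : P} (hsu : s < u) {l : List P}
    (h : IsSaturatedChain s u l) : ∃ t r, l = s :: t :: r := by
  obtain ⟨-, h2, h3⟩ := h
  match l with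
  | [] => simp at h2
  | [a] =>
    simp only [List.head?_cons, Option.some.injEq, List.getLast?_singleton] at h2 h3
    exact absurd (h2.symm.trans h3) hsu.ne
  | a :: t :: r =>
    simp only [List.head?_cons, Option.some.injEq] at h2
    exact ⟨t, r, by rw [h2]⟩

/-- The first steps `φ s u` of the increasing chains of the intervals `[s, u]`. -/
theorem IsELLabeling.exists_firstStep {lab : P → P → Λ} (hEL : IsELLabeling lab) :
    ∃ φ : P → P → P, (∀ s u, s < u → s ⋖ φ s u ∧ φ s u ≤ u) ∧
      ∀ s t u, s ⋖ t → t < u → (φ s u = t ↔ lab s t ≤ lab t (φ t u)) := by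
  have key : ∀ s u : P, ∃ x r, s < u → IsSaturatedChain s u (s :: x :: r) ∧
      (chainLabels lab (s :: x :: r)).IsChain (· ≤ ·) ∧
      ∀ l', IsSaturatedChain s u l' → (chainLabels lab l').IsChain (· ≤ ·) →
        l' = s :: x :: r := by
    intro s u
    by_cases hsu : s < u
    · obtain ⟨l, h1, h2, h3, -⟩ := hEL s u hsu.le
      obtain ⟨x, r, rfl⟩ := h1.exists_eq_cons hsu
      exact ⟨x, r, fun _ => ⟨h1, h2, h3⟩⟩
    · exact ⟨s, [], fun h => absurd h hsu⟩
  choose φ r hφ using key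
  refine ⟨φ, fun s u hsu => ⟨(hφ s u hsu).1.tail.1, (hφ s u hsu).1.tail.2.le⟩, ?_⟩
  intro s t u hst htu
  obtain ⟨h1, h2, h3⟩ := hφ s u (hst.lt.trans htu)
  obtain ⟨k1, k2, k3⟩ := hφ t u htu
  constructor
  · intro hx
    rw [hx] at h1 h2
    have hr := k3 (t :: r s u) h1.tail.2 (by
      simp only [chainLabels] at h2
      exact h2.tail)
    rw [hr] at h2
    simp only [chainLabels, List.isChain_cons_cons] at h2
    exact h2.1
  · intro hle
    have := h3 (s :: t :: φ t u :: r t u) (k1.cons hst) (by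
      simp only [chainLabels] at k2 ⊢
      exact List.isChain_cons_cons.mpr ⟨hle, k2⟩)
    simp only [List.cons.injEq] at this
    exact this.2.1.symm

theorem cons_le_cons_cases {a b : Λ} {l l' : List Λ} (h : a :: l ≤ b :: l') :
    a < b ∨ a = b ∧ l ≤ l' := by
  rcases lt_trichotomy a b with hab | rfl | hab
  · exact Or.inl hab
  · exact Or.inr ⟨rfl, not_lt.mp fun hl => not_lt.mpr h (List.Lex.cons hl)⟩
  · exact absurd (List.Lex.rel hab) (not_lt.mpr h)

/-- In an EL-labeled poset, an edge with the smallest label above `s` is never followed by a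
descent. -/
theorem IsELLabeling.le_of_minimal {lab : P → P → Λ} (hEL : IsELLabeling lab) {s t u : P}
    (hst : s ⋖ t) (hmin : ∀ t', s ⋖ t' → lab s t ≤ lab s t') (htu : t ⋖ u) :
    lab s t ≤ lab t u := by
  obtain ⟨l, h1, h2, -, h4⟩ := hEL s u (hst.lt.trans htu.lt).le
  obtain ⟨x, r, rfl⟩ := h1.exists_eq_cons (hst.lt.trans htu.lt)
  have hsx := h1.tail.1
  have hxu : x < u := h1.tail.2.le.lt_of_ne (by
    rintro rfl
    exact hsx.2 hst.lt htu.lt)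
  obtain ⟨y, r', hr⟩ := h1.tail.2.exists_eq_cons hxu
  obtain rfl : r = y :: r' := by simpa using hr
  -- The increasing chain s, x, y, … precedes s, t, u lexicographically. By minimality its first
  -- label equals `lab s t`, so its second is at most `lab t u`.
  have hlex := h4 [s, t, u] ⟨by simp [hst, htu], rfl, rfl⟩
  simp only [chainLabels, List.isChain_cons_cons] at h2 hlex
  rcases cons_le_cons_cases hlex with hlt | ⟨heq, hle⟩
  · exact absurd (hmin x hsx) (not_le.mpr hlt)
  · have hy : lab x y ≤ lab t u := by
      rcases cons_le_cons_cases hle with h | ⟨h, -⟩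
      · exact h.le
      · exact h.le
    rw [← heq]
    exact h2.1.trans hy

end FirstStep

section FirstStepSums

variable {P : Type u} [PartialOrder P] [Fintype P] {Λ : Type v} [LinearOrder Λ]

open Classical in
/-- The sum of `F` over the elements `u > s` with `φ s u = t`. -/
noncomputable def stepSum (φ : P → P → P) (F : P → ℂ) (s t : P) : ℂ :=
  ∑ u with s < u ∧ φ s u = t, F u

open Classical in
theorem sum_lt_eq_sum_stepSum {φ : P → P → P} (hφ : ∀ s u, s < u → s ⋖ φ s u ∧ φ s u ≤ u)
    (F : P → ℂ) (s : P) : ∑ u with s < u, F u = ∑ t ∈ coversAbove s, stepSum φ F s t := by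
  rw [← Finset.sum_fiberwise_of_maps_to (g := φ s) (t := coversAbove s)]
  · refine Finset.sum_congr rfl fun t _ => ?_
    rw [stepSum, Finset.filter_filter]
  · intro u hu
    rw [mem_coversAbove]
    exact (hφ s u (Finset.mem_filter.mp hu).2).1

/-- An increasing chain beginning with s ⋖ t either stops at t or continues with an ascent into an
increasing chain from t. -/
theorem stepSum_eq {lab : P → P → Λ} {φ : P → P → P}
    (hφ : ∀ s u, s < u → s ⋖ φ s u ∧ φ s u ≤ u)
    (hlab : ∀ s t u, s ⋖ t → t < u → (φ s u = t ↔ lab s t ≤ lab t (φ t u)))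
    (F : P → ℂ) {s t : P} (hst : s ⋖ t) :
    stepSum φ F s t = F t + ascSum lab (stepSum φ F) s t := by
  classical
  have hφt : φ s t = t := by
    obtain ⟨h1, h2⟩ := hφ s t hst.lt
    exact h2.eq_of_not_lt fun h => hst.2 h1.lt h
  have hsplit : (Finset.univ.filter fun u => s < u ∧ φ s u = t) =
      insert t (Finset.univ.filter fun u => t < u ∧ lab s t ≤ lab t (φ t u)) := by
    ext u
    simp only [Finset.mem_filter, Finset.mem_univ, true_and, Finset.mem_insert]
    constructor
    · rintro ⟨hsu, hu⟩
      rcases (hu ▸ (hφ s u hsu).2 : t ≤ u).eq_or_lt with h | h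
      · exact Or.inl h.symm
      · exact Or.inr ⟨h, (hlab s t u hst h).mp hu⟩
    · rintro (rfl | ⟨h, hle⟩)
      · exact ⟨hst.lt, hφt⟩
      · exact ⟨hst.lt.trans h, (hlab s t u hst h).mpr hle⟩
  rw [stepSum, hsplit, Finset.sum_insert (by simp)]
  congr 1
  rw [← Finset.sum_fiberwise_of_maps_to (g := φ t)
    (t := (coversAbove t).filter fun x => lab s t ≤ lab t x), ascSum]
  · refine Finset.sum_congr rfl fun x hx => ?_
    rw [stepSum]
    refine Finset.sum_congr ?_ fun _ _ => rfl
    ext u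
    simp only [Finset.mem_filter] at hx ⊢
    grind
  · intro u hu
    simp only [Finset.mem_filter, Finset.mem_univ, true_and] at hu
    rw [Finset.mem_filter, mem_coversAbove]
    exact ⟨(hφ t u hu.1).1, hu.2⟩

end FirstStepSums

/-! ### Ranks in a graded poset and in its dual. -/

section Rank

variable {P : Type u} [PartialOrder P]

theorem height_lt_top_of_finite [Finite P] (s : P) : Order.height s < ⊤ := by
  have := Fintype.ofFinite P
  rw [lt_top_iff_ne_top, ne_eq, Order.height_eq_top_iff]
  intro h
  obtain ⟨p, -, hp⟩ := h (Fintype.card P)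
  have := Fintype.card_le_of_injective p p.strictMono.injective
  rw [Fintype.card_fin, hp] at this
  omega

theorem rk_lt_rk [Finite P] {s t : P} (h : s < t) : rk s < rk t := by
  have hs := height_lt_top_of_finite s
  have ht := height_lt_top_of_finite t
  have hlt := Order.height_strictMono h hs
  rw [rk, rk]
  lift Order.height s to ℕ using hs.ne with a
  lift Order.height t to ℕ using ht.ne with b
  exact_mod_cast hlt

theorem rk_le_rk [Finite P] {s t : P} (h : s ≤ t) : rk s ≤ rk t := by
  rcases h.eq_or_lt with rfl | h
  · exact le_rfl
  · exact (rk_lt_rk h).le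

variable [BoundedOrder P]

theorem exists_cover_of_ne_top [Finite P] {s : P} (h : s ≠ ⊤) : ∃ t, s ⋖ t := by
  obtain ⟨t, ht, -⟩ := exists_covBy_le_of_lt (lt_top_iff_ne_top.mpr h)
  exact ⟨t, ht⟩

theorem eq_top_of_rk_eq [Finite P] {s : P} (h : rk s = rk (⊤ : P)) : s = ⊤ := by
  by_contra hs
  exact (rk_lt_rk (lt_top_iff_ne_top.mpr hs)).ne h

theorem IsGraded.rk_toDual_add_rk [Finite P] (hG : IsGraded P) (s : P) :
    rk (OrderDual.toDual s) + rk s = rk (⊤ : P) := by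
  suffices h : Order.coheight s = ((rk (⊤ : P) - rk s : ℕ) : ℕ∞) by
    have hs : rk (OrderDual.toDual s) = rk (⊤ : P) - rk s := by
      rw [rk, Order.height_toDual, h, ENat.toNat_natCast]
    have := rk_le_rk (le_top : s ≤ ⊤)
    omega
  induction s using WellFoundedGT.induction with
  | ind s ih =>
    apply le_antisymm
    · rw [Order.coheight_le_coe_iff]
      intro y hy
      rw [ih y hy]
      have h1 := rk_lt_rk hy
      have h2 := rk_le_rk (le_top : y ≤ ⊤)
      exact_mod_cast (by omega : rk (⊤ : P) - rk y < rk (⊤ : P) - rk s)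
    · by_cases hs : s = ⊤
      · simp [hs]
      · obtain ⟨t, ht⟩ := exists_cover_of_ne_top hs
        refine le_trans ?_ (Order.coheight_add_one_le ht.lt)
        rw [ih t ht.lt]
        have h1 := hG s t ht
        have h2 := rk_le_rk (le_top : t ≤ ⊤)
        exact_mod_cast (by omega : rk (⊤ : P) - rk s ≤ rk (⊤ : P) - rk t + 1)

end Rank

/-! ### Nonvanishing of the path sums. -/

section Nonvanishing

variable {P : Type u} [PartialOrder P] [BoundedOrder P] [Fintype P] {Λ : Type v} [LinearOrder Λ]

theorem IsGraded.sum_pathWeight_ne_zero {lab : P → P → Λ} (hG : IsGraded P)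
    (hEL : IsELLabeling lab) (hU : IsRankUniform lab) (hM : IsMonotonic lab) {τ v κ g₀ e₀ : ℂ}
    (hτ : τ = 0 ∨ τ = 1) (h₀ : Interlaces v e₀ (g₀ - e₀)) (hv : ∀ r : ℝ, r ≤ 0 → v ≠ r)
    (hκ : κ ≠ 0) (hg₀ : g₀ ≠ 0) (m : ℕ) :
    ∀ s : P, rk s + (m + 1) = rk (⊤ : P) →
      ∑ t ∈ coversAbove s, (pathWeight lab τ v κ g₀ e₀ m s t).1 ≠ 0 := by
  classical
  have main : ∀ (m : ℕ) (s : P), rk s + (m + 1) = rk (⊤ : P) → (∀ t, s ⋖ t →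
      (∀ t', s ⋖ t' → lab s t ≤ lab s t') → (pathWeight lab τ v κ g₀ e₀ m s t).1 ≠ 0) →
      ∑ t ∈ coversAbove s, (pathWeight lab τ v κ g₀ e₀ m s t).1 ≠ 0 := by
    intro m s hs hne
    have hs' : s ≠ ⊤ := by
      rintro rfl
      omega
    obtain ⟨t₁, ht₁⟩ := exists_cover_of_ne_top hs'
    obtain ⟨t, ht, hmin⟩ := Finset.exists_min_image (coversAbove s) (lab s)
      ⟨t₁, mem_coversAbove.mpr ht₁⟩
    have hst := mem_coversAbove.mp ht
    refine Interlaces.sum_ne_zero hv ht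
      (hne t hst fun t' ht' => hmin t' (mem_coversAbove.mpr ht')) fun t' ht' => ?_
    exact ((pathWeight_interlaces hG hU hM hτ h₀ m s t s t' rfl hst (mem_coversAbove.mp ht')).2.1
      (ind_le_ind (hmin t' ht'))).1
  induction m with
  | zero => exact fun s hs => main _ s hs fun _ _ _ => hg₀
  | succ m ih =>
    refine fun s hs => main _ s hs fun t hst hmin => ?_
    -- With no descent after the minimal edge, its weight is κ times the full sum above t.
    have hle : ∀ u ∈ coversAbove t, lab s t ≤ lab t u := fun u hu =>
      hEL.le_of_minimal hst hmin (mem_coversAbove.mp hu)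
    simp only [pathWeight]
    rw [ascSum, desSum, Finset.filter_true_of_mem hle,
      Finset.filter_false_of_mem fun u hu => not_lt.mpr (hle u hu), Finset.sum_empty, mul_zero,
      add_zero]
    exact mul_ne_zero hκ (ih t (by rw [hG s t hst]; omega))

end Nonvanishing

/-! ### The Chow recursion without the Möbius function. -/

section ChowRecursion

variable {Q : Type*} [PartialOrder Q] [LocallyFiniteOrder Q] [DecidableEq Q]

theorem charPoly_self (s : Q) : charPoly s s = 1 := by simp [charPoly]

theorem X_sub_one_mul_redCharPoly {s t : Q} (h : s ≠ t) :
    (X - 1) * redCharPoly s t = charPoly s t := by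
  have hroot : (charPoly s t).IsRoot 1 := by
    rw [IsRoot.def, charPoly, eval_finsetSum]
    simp [IncidenceAlgebra.sum_Icc_mu_right, h]
  have := mul_divByMonic_eq_iff_isRoot.mpr hroot
  rwa [C_1] at this

variable [BoundedOrder Q]

theorem sum_charPoly_mul_chowAbove (z : ℂ) (s : Q) :
    ∑ u ∈ Finset.Icc s ⊤, aeval z (charPoly s u) * aeval z (chowAbove u) =
      z * aeval z (chowAbove s) + if s = ⊤ then 1 - z else 0 := by
  rw [← Finset.Ioc_insert_left le_top, Finset.sum_insert (by simp), charPoly_self]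
  have hH := congrArg (aeval z) (chowAbove_eq s)
  by_cases hs : s = ⊤
  · subst hs
    simp only [if_true, map_one] at hH
    simp [hH]
  · rw [if_neg hs, map_sum] at hH
    rw [if_neg hs, map_one, one_mul, add_zero]
    have : ∑ u ∈ Finset.Ioc s ⊤, aeval z (charPoly s u) * aeval z (chowAbove u) =
        (z - 1) * aeval z (chowAbove s) := by
      rw [hH, Finset.mul_sum]
      refine Finset.sum_congr rfl fun u hu => ?_
      rw [← X_sub_one_mul_redCharPoly (Finset.mem_Ioc.mp hu).1.ne]
      simp only [map_mul, map_sub, aeval_X, map_one]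
      ring
    rw [this]
    ring

/-- Summing `sum_charPoly_mul_chowAbove` over all w ≥ s cancels the Möbius function. -/
theorem sum_sub_pow_mul_chowAbove (z : ℂ) (s : Q) :
    ∑ u ∈ Finset.Icc s ⊤, (z - z ^ (rk u - rk s)) * aeval z (chowAbove u) = z - 1 := by
  set H : Q → ℂ := fun u => aeval z (chowAbove u) with hH
  set Y : Q → ℂ := fun w => ∑ u ∈ Finset.Icc w ⊤, z ^ (rk u - rk w) * H u with hY
  have h1 : ∀ w : Q, ∑ x ∈ Finset.Icc w ⊤, (IncidenceAlgebra.mu ℤ w x : ℂ) * Y x =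
      z * H w + if w = ⊤ then 1 - z else 0 := by
    intro w
    rw [← sum_charPoly_mul_chowAbove]
    simp only [hY, charPoly, map_sum, Finset.mul_sum, Finset.sum_mul]
    rw [Finset.sum_comm' (t' := Finset.Icc w ⊤) (s' := fun u => Finset.Icc w u)]
    · refine Finset.sum_congr rfl fun u _ => Finset.sum_congr rfl fun x _ => ?_
      simp [hH, mul_assoc]
    · intro x u
      simp only [Finset.mem_Icc, le_top, and_true]
      exact ⟨fun h => ⟨⟨h.1, h.2⟩, h.1.trans h.2⟩, fun h => h.1⟩
  have h2 : ∑ w ∈ Finset.Icc s ⊤, ∑ x ∈ Finset.Icc w ⊤, (IncidenceAlgebra.mu ℤ w x : ℂ) * Y x =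
      Y s := by
    rw [Finset.sum_comm' (t' := Finset.Icc s ⊤) (s' := fun x => Finset.Icc s x)]
    · have : ∀ x, ∑ w ∈ Finset.Icc s x, (IncidenceAlgebra.mu ℤ w x : ℂ) * Y x =
          if s = x then Y x else 0 := by
        intro x
        rw [← Finset.sum_mul, ← Int.cast_sum, IncidenceAlgebra.sum_Icc_mu_left]
        split_ifs <;> simp
      simp_rw [this]
      simp
    · intro w x
      simp only [Finset.mem_Icc, le_top, and_true]
      exact ⟨fun h => ⟨⟨h.1, h.2⟩, h.1.trans h.2⟩, fun h => h.1⟩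
  simp_rw [h1] at h2
  rw [Finset.sum_add_distrib, ← Finset.mul_sum, Finset.sum_ite_eq' (Finset.Icc s ⊤),
    if_pos (by simp)] at h2
  simp only [sub_mul, Finset.sum_sub_distrib, ← Finset.mul_sum]
  linear_combination h2

end ChowRecursion

/-! ### Weights on the poset built from path sums. -/

section ChowSums

variable {P : Type u} [PartialOrder P] [Fintype P] {Λ : Type v} [LinearOrder Λ]

open Classical in
theorem sum_le_eq (F : P → ℂ) (s : P) :
    ∑ u with s ≤ u, F u = F s + ∑ u with s < u, F u := by
  rw [show (Finset.univ.filter fun u => s ≤ u) = insert s (Finset.univ.filter fun u => s < u) by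
    ext u; simp [le_iff_eq_or_lt, eq_comm], Finset.sum_insert (by simp)]

open Classical in
-- The sums of A and of its rank-twisted form A' over t ≥ u are both multiples of one path sum, with
-- ratio z^(rk u + 1); eliminating it gives the identity. The parameter c₀ sets the correction at ⊤,
-- and `h₁`, `h₂` are the initial conditions for A and A'.
theorem exists_chow_weights [BoundedOrder P] {lab : P → P → Λ} (hG : IsGraded P)
    (hEL : IsELLabeling lab) (hU : IsRankUniform lab) (hM : IsMonotonic lab) {z g₀ e₀ c₀ : ℂ}
    (hz : z ≠ 0) (hz1 : 1 + z ≠ 0) (hv : ∀ r : ℝ, r ≤ 0 → z / (1 + z) ^ 2 ≠ r)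
    (h₀ : Interlaces (z / (1 + z) ^ 2) e₀ (g₀ - e₀)) (hg₀ : g₀ ≠ 0)
    (h₁ : (1 + z) * g₀ - z * e₀ = 1 + z) (h₂ : (1 + z) * g₀ - e₀ = (1 + z) * c₀) :
    ∃ A : P → ℂ, A ⊤ = 1 ∧ ∑ t, A t ≠ 0 ∧ ∀ u : P, u ≠ ⊤ →
      ∑ t with u ≤ t, (z - z ^ (rk t - rk u)) * A t = z ^ (rk (⊤ : P) - rk u) * (c₀ - 1) := by
  obtain ⟨φ, hφ, hlab⟩ := hEL.exists_firstStep
  set v := z / (1 + z) ^ 2 with hvdef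
  set α : ℕ → P → P → ℂ := fun m s t => (pathWeight lab 0 v (1 + z) g₀ e₀ m s t).1 with hα
  -- The factor z/(1+z) is κ v, so β absorbs the weight of a descent.
  set β : ℕ → P → P → ℂ := fun m s t =>
    z / (1 + z) * (pathWeight lab 0 v (1 + z) g₀ e₀ m s t).2 with hβ
  have hαβ : ∀ m s t, α (m + 1) s t = (1 + z) * ascSum lab (α m) s t + desSum lab (β m) s t := by
    intro m s t
    simp only [hα, hβ, pathWeight, desSum, ← Finset.mul_sum]
    rw [hvdef]
    field_simp
  have hβα : ∀ m s t, β (m + 1) s t = z * ascSum lab (α m) s t := by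
    intro m s t
    simp only [hα, hβ, pathWeight]
    field_simp
    ring
  set A : P → ℂ := fun s =>
    if s = ⊤ then 1 else ∑ t ∈ coversAbove s, β (rk (⊤ : P) - rk s - 1) s t with hA
  set A' : P → ℂ := fun s => z ^ rk s * (A s + if s = ⊤ then c₀ - 1 else 0) with hA'
  have hAtop : A ⊤ = 1 := by simp [hA]
  have hAne : ∀ (m : ℕ) (s : P), rk s + (m + 1) = rk (⊤ : P) →
      s ≠ ⊤ ∧ A s = ∑ t ∈ coversAbove s, β m s t := by
    intro m s hs
    have : s ≠ ⊤ := by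
      rintro rfl
      omega
    refine ⟨this, ?_⟩
    simp only [hA]
    rw [if_neg this, show rk (⊤ : P) - rk s - 1 = m by omega]
  have hstep : ∀ (m : ℕ) (s t : P), s ⋖ t → rk t + m = rk (⊤ : P) →
      stepSum φ A s t = α m s t - β m s t ∧
      stepSum φ A' s t = z ^ rk s * (z * α m s t - β m s t) := by
    intro m
    induction m with
    | zero =>
      intro s t hst ht
      obtain rfl := eq_top_of_rk_eq (by simpa using ht)
      rw [stepSum_eq hφ hlab A hst, stepSum_eq hφ hlab A' hst]
      have h0 : ∀ F : P → P → ℂ, ascSum lab F s ⊤ = 0 := fun F =>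
        Finset.sum_eq_zero fun u hu =>
          absurd (mem_coversAbove.mp (Finset.mem_filter.mp hu).1).lt not_top_lt
      rw [h0, h0, add_zero, add_zero, hAtop]
      simp only [hA', hAtop, if_true, hα, hβ, pathWeight]
      rw [hG s ⊤ hst]
      constructor
      · field_simp
        linear_combination -h₁
      · field_simp
        rw [pow_succ]
        linear_combination (-z ^ rk s * z) * h₂
    | succ m ih =>
      intro s t hst ht
      rw [stepSum_eq hφ hlab A hst, stepSum_eq hφ hlab A' hst]
      obtain ⟨htop, hAt⟩ := hAne m t ht
      have e1 : ascSum lab (stepSum φ A) s t = ascSum lab (α m) s t - ascSum lab (β m) s t := by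
        simp only [ascSum]
        rw [← Finset.sum_sub_distrib]
        refine Finset.sum_congr rfl fun u hu => ?_
        have hu := mem_coversAbove.mp (Finset.mem_filter.mp hu).1
        exact (ih t u hu (by rw [hG t u hu]; omega)).1
      have e2 : ascSum lab (stepSum φ A') s t =
          z ^ rk t * (z * ascSum lab (α m) s t - ascSum lab (β m) s t) := by
        simp only [ascSum]
        rw [Finset.mul_sum, ← Finset.sum_sub_distrib, Finset.mul_sum]
        refine Finset.sum_congr rfl fun u hu => ?_
        have hu := mem_coversAbove.mp (Finset.mem_filter.mp hu).1
        exact (ih t u hu (by rw [hG t u hu]; omega)).2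
      have hA't : A' t = z ^ rk t * A t := by simp [hA', htop]
      rw [e1, e2, hA't, hAt, ← ascSum_add_desSum lab (β m) s t, hαβ, hβα, hG s t hst]
      constructor <;> ring
  have hsum : ∀ (m : ℕ) (s : P), rk s + (m + 1) = rk (⊤ : P) →
      ∑ u with s ≤ u, A u = ∑ t ∈ coversAbove s, α m s t ∧
      ∑ u with s ≤ u, A' u = z ^ rk s * (z * ∑ t ∈ coversAbove s, α m s t) := by
    intro m s hs
    obtain ⟨htop, hAs⟩ := hAne m s hs
    have hA's : A' s = z ^ rk s * A s := by simp [hA', htop]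
    rw [sum_le_eq, sum_le_eq, sum_lt_eq_sum_stepSum hφ, sum_lt_eq_sum_stepSum hφ, hA's, hAs,
      Finset.mul_sum, Finset.mul_sum, Finset.mul_sum, ← Finset.sum_add_distrib,
      ← Finset.sum_add_distrib]
    constructor
    · refine Finset.sum_congr rfl fun t ht => ?_
      have ht := mem_coversAbove.mp ht
      rw [(hstep m s t ht (by rw [hG s t ht]; omega)).1]
      ring
    · refine Finset.sum_congr rfl fun t ht => ?_
      have ht := mem_coversAbove.mp ht
      rw [(hstep m s t ht (by rw [hG s t ht]; omega)).2]
      ring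
  have hrk : ∀ s : P, s ≠ ⊤ → rk s + ((rk (⊤ : P) - rk s - 1) + 1) = rk (⊤ : P) := by
    intro s hs
    have := rk_lt_rk (lt_top_iff_ne_top.mpr hs)
    omega
  refine ⟨A, hAtop, ?_, ?_⟩
  · by_cases hbot : (⊥ : P) = ⊤
    · have : Subsingleton P := subsingleton_of_bot_eq_top hbot
      rw [Fintype.sum_subsingleton A ⊤, hAtop]
      exact one_ne_zero
    · have h := (hsum _ ⊥ (hrk ⊥ hbot)).1
      simp only [bot_le, Finset.filter_true] at h
      rw [h]
      exact hG.sum_pathWeight_ne_zero hEL hU hM (Or.inl rfl) h₀ hv hz1 hg₀ _ ⊥ (hrk ⊥ hbot)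
  · intro u hu
    obtain ⟨s1, s2⟩ := hsum _ u (hrk u hu)
    have hzu : z ^ rk u ≠ 0 := pow_ne_zero _ hz
    have hA'sum : ∑ t with u ≤ t, A' t =
        ∑ t with u ≤ t, z ^ rk t * A t + z ^ rk (⊤ : P) * (c₀ - 1) := by
      simp only [hA', mul_add, Finset.sum_add_distrib, mul_ite, mul_zero]
      rw [Finset.sum_ite_eq', if_pos (by simp)]
    have hpow : ∀ t, u ≤ t → z ^ rk u * z ^ (rk t - rk u) = z ^ rk t := fun t ht => by
      rw [← pow_add, Nat.add_sub_cancel' (rk_le_rk ht)]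
    apply mul_left_cancel₀ hzu
    rw [← mul_assoc, hpow ⊤ le_top, Finset.mul_sum]
    have : ∀ t ∈ Finset.univ.filter fun t => u ≤ t,
        z ^ rk u * ((z - z ^ (rk t - rk u)) * A t) = z ^ rk u * z * A t - z ^ rk t * A t := by
      intro t ht
      rw [← hpow t (by simpa using ht)]
      ring
    rw [Finset.sum_congr rfl this, Finset.sum_sub_distrib, ← Finset.mul_sum, s1]
    linear_combination hA'sum - s2

end ChowSums

/-! ### Chow polynomials of the dual. -/

section DualChow

variable {P : Type u} [PartialOrder P] [BoundedOrder P] [Fintype P] [LocallyFiniteOrder P]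
  [DecidableEq P]

open Classical in
theorem IsGraded.sum_sub_pow_mul_chowAbove_dual (hG : IsGraded P) (z : ℂ) (t : P) :
    ∑ u with u ≤ t, (z - z ^ (rk t - rk u)) * aeval z (chowAbove (OrderDual.toDual u)) =
      z - 1 := by
  rw [← sum_sub_pow_mul_chowAbove z (OrderDual.toDual t)]
  refine Finset.sum_bij' (fun u _ => OrderDual.toDual u) (fun u _ => OrderDual.ofDual u)
    (fun u hu => ?_) (fun u hu => ?_) (fun _ _ => rfl) (fun _ _ => rfl) fun u hu => ?_
  · simpa using hu
  · exact Finset.mem_filter.mpr ⟨Finset.mem_univ _, (Finset.mem_Icc.mp hu).1⟩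
  · have h1 := hG.rk_toDual_add_rk u
    have h2 := hG.rk_toDual_add_rk t
    have h3 := rk_le_rk (Finset.mem_filter.mp hu).2
    rw [show rk (OrderDual.toDual u) - rk (OrderDual.toDual t) = rk t - rk u by omega]

open Classical in
-- Double counting over pairs u ≤ t: the dual recursion evaluates the sum over u, the hypothesis on
-- A the sum over t. Taking c₀ = 1 leaves only u = ⊤, the bottom of the dual; c₀ = z gives the
-- augmented sum.
theorem IsGraded.sum_chow_weights (hG : IsGraded P) {z c₀ : ℂ} {A : P → ℂ} (hA : A ⊤ = 1)
    (h : ∀ u : P, u ≠ ⊤ →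
      ∑ t with u ≤ t, (z - z ^ (rk t - rk u)) * A t = z ^ (rk (⊤ : P) - rk u) * (c₀ - 1)) :
    (z - 1) * ∑ t, A t = ∑ u : P, (z ^ (rk (⊤ : P) - rk u) * (c₀ - 1) +
      if u = ⊤ then z - c₀ else 0) * aeval z (chowAbove (OrderDual.toDual u)) := by
  have hcomm : (z - 1) * ∑ t, A t = ∑ u : P, (∑ t with u ≤ t, (z - z ^ (rk t - rk u)) * A t) *
      aeval z (chowAbove (OrderDual.toDual u)) := by
    simp only [Finset.mul_sum, Finset.sum_mul]
    rw [Finset.sum_comm' (t' := Finset.univ) (s' := fun t => Finset.univ.filter fun u => u ≤ t)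
      (by simp)]
    refine Finset.sum_congr rfl fun t _ => ?_
    rw [← hG.sum_sub_pow_mul_chowAbove_dual z t, Finset.sum_mul]
    exact Finset.sum_congr rfl fun u _ => by ring
  rw [hcomm]
  refine Finset.sum_congr rfl fun u _ => ?_
  congr 1
  by_cases hu : u = ⊤
  · subst hu
    rw [show (Finset.univ.filter fun t : P => ⊤ ≤ t) = {⊤} by ext; simp]
    simp [hA]
  · rw [h u hu, if_neg hu, add_zero]

theorem div_one_add_sq_ne {z : ℂ} (hz : z.im ≠ 0) (r : ℝ) (hr : r ≤ 0) :
    z / (1 + z) ^ 2 ≠ r := by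
  intro h
  have h1 : (1 + z) ≠ 0 := fun h0 => hz (by simpa using congrArg Complex.im h0)
  rw [div_eq_iff (pow_ne_zero _ h1)] at h
  have him := congrArg Complex.im h
  have hre := congrArg Complex.re h
  simp [pow_two] at him hre
  -- This forces 1 + Re z < 0, whereas the real part yields Re z - 1 = -2 r (Im z)^2 ≥ 0.
  have him' : 1 = 2 * r * (1 + z.re) := mul_right_cancel₀ hz (by linear_combination him)
  have hy : 0 < z.im ^ 2 := by positivity
  nlinarith [mul_nonneg (neg_nonneg.mpr hr) hy.le, sq_nonneg (1 + z.re), sq_nonneg r]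

variable {Λ : Type v} [LinearOrder Λ]

theorem realRooted_chowPoly_dual {lab : P → P → Λ} (hG : IsGraded P) (hEL : IsELLabeling lab)
    (hU : IsRankUniform lab) (hM : IsMonotonic lab) : RealRooted (chowPoly Pᵒᵈ) := by
  intro z h
  by_contra hz
  have hz0 : z ≠ 0 := fun h0 => hz (by simp [h0])
  have hz1 : 1 + z ≠ 0 := fun h0 => hz (by simpa using congrArg Complex.im h0)
  have hz2 : z - 1 ≠ 0 := fun h0 => hz (by simpa using congrArg Complex.im h0)
  obtain ⟨A, hA, hne, hsum⟩ := exists_chow_weights hG hEL hU hM (g₀ := 1) (e₀ := 0) (c₀ := 1)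
    hz0 hz1 (div_one_add_sq_ne hz) (Interlaces.zero_left _ _) one_ne_zero (by ring) (by ring)
  have key := hG.sum_chow_weights hA hsum
  have key' : ∑ t, A t = aeval z (chowPoly Pᵒᵈ) := by
    simpa [hz2, chowPoly] using key
  exact hne (key'.trans h)

theorem realRooted_augChowPoly_dual {lab : P → P → Λ} (hG : IsGraded P) (hEL : IsELLabeling lab)
    (hU : IsRankUniform lab) (hM : IsMonotonic lab) : RealRooted (augChowPoly Pᵒᵈ) := by
  intro z h
  by_contra hz
  have hz0 : z ≠ 0 := fun h0 => hz (by simp [h0])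
  have hz1 : 1 + z ≠ 0 := fun h0 => hz (by simpa using congrArg Complex.im h0)
  have hz2 : z - 1 ≠ 0 := fun h0 => hz (by simpa using congrArg Complex.im h0)
  obtain ⟨A, hA, hne, hsum⟩ := exists_chow_weights hG hEL hU hM (g₀ := 1 + z) (e₀ := 1 + z)
    (c₀ := z) hz0 hz1 (div_one_add_sq_ne hz) (by simpa using Interlaces.zero_right _ _) hz1
    (by ring) (by ring)
  have key := hG.sum_chow_weights hA hsum
  have haug : ∑ u : P, z ^ (rk (⊤ : P) - rk u) * aeval z (chowAbove (OrderDual.toDual u)) = 0 := by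
    rw [← h, augChowPoly, map_sum]
    refine Finset.sum_bij' (fun u _ => OrderDual.toDual u) (fun u _ => OrderDual.ofDual u)
      (fun u _ => by simp) (fun u _ => by simp) (fun _ _ => rfl) (fun _ _ => rfl) fun u _ => ?_
    have h1 := hG.rk_toDual_add_rk u
    rw [map_mul, map_pow, aeval_X, show rk (OrderDual.toDual u) = rk (⊤ : P) - rk u by omega]
  have : (z - 1) * ∑ t, A t = 0 := by
    calc (z - 1) * ∑ t, A t = (z - 1) *
          ∑ u : P, z ^ (rk (⊤ : P) - rk u) * aeval z (chowAbove (OrderDual.toDual u)) := by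
          rw [key, Finset.mul_sum]
          refine Finset.sum_congr rfl fun u _ => ?_
          simp only [sub_self, ite_self]
          ring
      _ = 0 := by rw [haug, mul_zero]
  exact (mul_ne_zero hz2 hne) this

end DualChow

/-! ### Generating functions of chains. -/

section ChainSums

variable {P : Type u} [PartialOrder P]

theorem exists_least_of_isChain {c : Finset P} (hc : IsChain (· ≤ ·) (c : Set P))
    (hne : c.Nonempty) : ∃ s ∈ c, ∀ t ∈ c, s ≤ t := by
  obtain ⟨s, hs⟩ := c.exists_minimal hne
  refine ⟨s, hs.1, fun t ht => ?_⟩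
  rcases hc.total hs.1 ht with h | h
  · exact h
  · exact hs.2 ht h

open Classical in
/-- The generating polynomial of the chains contained in `U`, by cardinality. -/
noncomputable def chainSum (q : ℂ) (U : Finset P) : ℂ :=
  ∑ c ∈ U.powerset.filter fun c : Finset P => IsChain (· ≤ ·) (c : Set P), q ^ c.card

open Classical in
-- Nonempty chains are sorted by their least element.
theorem chainSum_eq [Fintype P] (q : ℂ) {U : Finset P} (hU : ∀ s ∈ U, ∀ t, s < t → t ∈ U) :
    chainSum q U = 1 + q * ∑ s ∈ U, chainSum q (Finset.univ.filter (s < ·)) := by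
  set S := (U.powerset.filter fun c : Finset P => IsChain (· ≤ ·) (c : Set P)) with hS
  have hempty : ∅ ∈ S := by simp [hS]
  rw [chainSum, ← hS, ← Finset.add_sum_erase S _ hempty, Finset.card_empty, pow_zero]
  congr 1
  simp only [chainSum, Finset.mul_sum]
  rw [Finset.sum_sigma']
  symm
  refine Finset.sum_bij (fun x _ => insert x.1 x.2) ?_ ?_ ?_ ?_
  · rintro ⟨s, c⟩ hx
    simp only [Finset.mem_sigma, Finset.mem_filter, Finset.mem_powerset] at hx
    obtain ⟨hs, hc, hch⟩ := hx
    have hlt : ∀ t ∈ c, s < t := fun t ht => by simpa using hc ht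
    simp only [hS, Finset.mem_erase, Finset.mem_filter, Finset.mem_powerset]
    refine ⟨Finset.insert_ne_empty _ _, Finset.insert_subset hs fun t ht => hU s hs t (hlt t ht),
      ?_⟩
    rw [Finset.coe_insert]
    exact hch.insert fun t ht _ => Or.inl (hlt t ht).le
  · rintro ⟨s, c⟩ hx ⟨s', c'⟩ hx' heq
    simp only [Finset.mem_sigma, Finset.mem_filter, Finset.mem_powerset] at hx hx' heq
    have hlt : ∀ t ∈ c, s < t := fun t ht => by simpa using hx.2.1 ht
    have hlt' : ∀ t ∈ c', s' < t := fun t ht => by simpa using hx'.2.1 ht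
    have hss : s = s' := by
      have h1 : s ∈ insert s' c' := heq ▸ Finset.mem_insert_self s c
      have h2 : s' ∈ insert s c := heq ▸ Finset.mem_insert_self s' c'
      rcases Finset.mem_insert.mp h1 with h1 | h1
      · exact h1
      · rcases Finset.mem_insert.mp h2 with h2 | h2
        · exact h2.symm
        · exact absurd (hlt _ h2) (hlt' _ h1).not_gt
    subst hss
    have hcc : c = c' := by
      rw [← Finset.erase_insert (fun h => (hlt s h).false : s ∉ c), heq,
        Finset.erase_insert (fun h => (hlt' s h).false)]
    rw [hcc]
  · intro c hc
    simp only [hS, Finset.mem_erase, Finset.mem_filter, Finset.mem_powerset] at hc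
    obtain ⟨hne, hcU, hch⟩ := hc
    obtain ⟨s, hs, hmin⟩ := exists_least_of_isChain hch (Finset.nonempty_iff_ne_empty.mpr hne)
    refine ⟨⟨s, c.erase s⟩, ?_, Finset.insert_erase hs⟩
    simp only [Finset.mem_sigma, Finset.mem_filter, Finset.mem_powerset]
    refine ⟨hcU hs, fun t ht => ?_, hch.mono (by simp)⟩
    rw [Finset.mem_erase] at ht
    simpa using (hmin t ht.2).lt_of_ne ht.1.symm
  · rintro ⟨s, c⟩ hx
    simp only [Finset.mem_sigma, Finset.mem_filter, Finset.mem_powerset] at hx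
    have hlt : ∀ t ∈ c, s < t := fun t ht => by simpa using hx.2.1 ht
    rw [Finset.card_insert_of_notMem fun h => (hlt s h).false, pow_succ, mul_comm]

end ChainSums

/-! ### The h-polynomial. -/

section HPoly

variable {P : Type u} [PartialOrder P] [Fintype P]

theorem mem_orderComplexFaces {c : Finset P} :
    c ∈ orderComplexFaces P ↔ IsChain (· ≤ ·) (c : Set P) := by
  simp [orderComplexFaces]

theorem hPoly_dual (P : Type u) [PartialOrder P] [Fintype P] : hPoly Pᵒᵈ = hPoly P := by
  have hiff : ∀ c : Set P, IsChain (α := Pᵒᵈ) (· ≤ ·) c ↔ IsChain (α := P) (· ≤ ·) c :=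
    fun _ => ⟨IsChain.symm, IsChain.symm⟩
  have : orderComplexFaces Pᵒᵈ = orderComplexFaces P := Finset.ext fun (c : Finset P) =>
    (mem_orderComplexFaces (P := Pᵒᵈ) (c := c)).trans
      ((hiff c).trans (mem_orderComplexFaces (P := P) (c := c)).symm)
  exact congrArg hPolyOfFaces this

theorem aeval_hPoly {y : ℂ} (hy : 1 - y ≠ 0) : ∃ d : ℕ,
    aeval y (hPoly P) = (1 - y) ^ d * chainSum (y / (1 - y)) (Finset.univ : Finset P) := by
  classical
  refine ⟨(orderComplexFaces P).sup Finset.card, ?_⟩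
  set d := (orderComplexFaces P).sup Finset.card with hd
  have hc : chainSum (y / (1 - y)) (Finset.univ : Finset P) =
      ∑ c ∈ orderComplexFaces P, (y / (1 - y)) ^ c.card := by
    rw [chainSum, orderComplexFaces, Finset.powerset_univ]
  rw [hc, ← Finset.sum_fiberwise_of_maps_to (g := Finset.card) (t := Finset.range (d + 1))
    fun c hc => Finset.mem_range.mpr (Nat.lt_succ_of_le (Finset.le_sup (f := Finset.card) hc)),
    hPoly, hPolyOfFaces, ← hd, map_sum, Finset.mul_sum]
  refine Finset.sum_congr rfl fun i hi => ?_
  have hi : i ≤ d := Nat.lt_succ_iff.mp (Finset.mem_range.mp hi)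
  rw [Finset.sum_congr rfl fun c hc => by rw [(Finset.mem_filter.mp hc).2], Finset.sum_const,
    nsmul_eq_mul, div_pow]
  have hpow : (1 - y) ^ d = (1 - y) ^ (d - i) * (1 - y) ^ i := by
    rw [← pow_add, Nat.sub_add_cancel hi]
  rw [hpow]
  simp only [map_mul, map_pow, map_sub, map_one, aeval_X]
  field_simp
  simp [mul_comm]

variable [BoundedOrder P] {Λ : Type v} [LinearOrder Λ]

theorem realRooted_hPoly {lab : P → P → Λ} (hG : IsGraded P) (hEL : IsELLabeling lab)
    (hU : IsRankUniform lab) (hM : IsMonotonic lab) : RealRooted (hPoly P) := by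
  classical
  intro y h
  by_contra hy
  have hy0 : y ≠ 0 := fun h0 => hy (by simp [h0])
  have hy1 : 1 - y ≠ 0 := fun h0 => hy (by simpa using congrArg Complex.im h0)
  have hv : ∀ r : ℝ, r ≤ 0 → y ≠ r := fun r _ h0 => hy (by simp [h0])
  set q := y / (1 - y) with hq
  have hq1 : 1 + q = 1 / (1 - y) := by rw [hq]; field_simp; ring
  have hq0 : q ≠ 0 := div_ne_zero hy0 hy1
  have hqq : 1 + q ≠ 0 := by rw [hq1]; exact one_div_ne_zero hy1
  have hqy : (1 + q) * y = q := by rw [hq1, hq]; field_simp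
  obtain ⟨d, hd⟩ := aeval_hPoly (P := P) hy1
  rw [h] at hd
  have hzero : chainSum q (Finset.univ : Finset P) = 0 := by
    rcases mul_eq_zero.mp hd.symm with h | h
    · exact absurd h (pow_ne_zero _ hy1)
    · exact h
  set M : P → ℂ := fun s => chainSum q (Finset.univ.filter (s < ·)) with hM'
  have hMs : ∀ s, M s = 1 + q * ∑ u with s < u, M u := fun s =>
    chainSum_eq q fun a ha b hab => by
      simp only [Finset.mem_filter, Finset.mem_univ, true_and] at ha ⊢
      exact ha.trans hab
  have htotal : chainSum q (Finset.univ : Finset P) = (1 + q) * M ⊥ := by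
    rw [chainSum_eq q fun _ _ _ _ => Finset.mem_univ _]
    have := sum_le_eq M ⊥
    simp only [bot_le, Finset.filter_true] at this
    rw [this]
    linear_combination -hMs ⊥
  have hMbot : M ⊥ = 0 := by
    rw [htotal] at hzero
    exact (mul_eq_zero.mp hzero).resolve_left hqq
  have hMtop : M ⊤ = 1 := by
    rw [hMs ⊤, Finset.sum_eq_zero, mul_zero, add_zero]
    intro u hu
    exact absurd (Finset.mem_filter.mp hu).2 not_top_lt
  by_cases hbot : (⊥ : P) = ⊤
  · rw [hbot, hMtop] at hMbot
    exact one_ne_zero hMbot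
  obtain ⟨φ, hφ, hlab⟩ := hEL.exists_firstStep
  -- The extra 1/q at ⊤ absorbs the constant 1 of the recursion for M and makes it homogeneous below
  -- ⊤; also f ⊤ = 1 + 1/q = 1/y, the initial path weight.
  set f : P → ℂ := fun s => M s + if s = ⊤ then 1 / q else 0 with hf
  have hMf : ∀ s, s ≠ ⊤ → M s = q * ∑ t ∈ coversAbove s, stepSum φ f s t := by
    intro s hs
    rw [← sum_lt_eq_sum_stepSum hφ, hMs s]
    simp only [hf, Finset.sum_add_distrib]
    rw [Finset.sum_ite_eq', if_pos (by simpa using lt_top_iff_ne_top.mpr hs)]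
    field_simp
    ring
  have hstep : ∀ (m : ℕ) (s t : P), s ⋖ t → rk t + m = rk (⊤ : P) →
      stepSum φ f s t = (pathWeight lab 1 y (1 + q) (1 / y) (1 / y) m s t).1 ∧
      stepSum φ f s t = (pathWeight lab 1 y (1 + q) (1 / y) (1 / y) m s t).2 := by
    intro m
    induction m with
    | zero =>
      intro s t hst ht
      obtain rfl := eq_top_of_rk_eq (by simpa using ht)
      have h0 : ascSum lab (stepSum φ f) s ⊤ = 0 := Finset.sum_eq_zero fun u hu =>
        absurd (mem_coversAbove.mp (Finset.mem_filter.mp hu).1).lt not_top_lt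
      rw [stepSum_eq hφ hlab f hst, h0]
      simp only [hf, hMtop, if_true, pathWeight, hq]
      constructor <;> · field_simp; ring
    | succ m ih =>
      intro s t hst ht
      have htop : t ≠ ⊤ := by
        rintro rfl
        omega
      have hft : f t = q * ∑ u ∈ coversAbove t, stepSum φ f t u := by
        rw [← hMf t htop]
        simp [hf, htop]
      have hu : ∀ u, t ⋖ u → rk u + m = rk (⊤ : P) := fun u hu => by
        rw [hG t u hu]
        omega
      have e1 : ascSum lab (stepSum φ f) s t = ascSum lab
          (fun a b => (pathWeight lab 1 y (1 + q) (1 / y) (1 / y) m a b).1) s t :=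
        Finset.sum_congr rfl fun u h' => by
          have h' := mem_coversAbove.mp (Finset.mem_filter.mp h').1
          exact (ih t u h' (hu u h')).1
      have e2 : desSum lab (stepSum φ f) s t = desSum lab
          (fun a b => (pathWeight lab 1 y (1 + q) (1 / y) (1 / y) m a b).2) s t :=
        Finset.sum_congr rfl fun u h' => by
          have h' := mem_coversAbove.mp (Finset.mem_filter.mp h').1
          exact (ih t u h' (hu u h')).2
      rw [stepSum_eq hφ hlab f hst, hft, ← ascSum_add_desSum lab]
      simp only [pathWeight]
      rw [← e1, ← e2, one_mul, and_self]
      -- Ascents occur with weight q + 1 and descents with q = (1 + q) y, so κ = 1 + q and v = y.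
      linear_combination (-desSum lab (stepSum φ f) s t) * hqy
  have hm : rk (⊥ : P) + ((rk (⊤ : P) - rk (⊥ : P) - 1) + 1) = rk (⊤ : P) := by
    have := rk_lt_rk (lt_top_iff_ne_top.mpr hbot)
    omega
  refine hG.sum_pathWeight_ne_zero hEL hU hM (Or.inr rfl) (v := y) (κ := 1 + q) (g₀ := 1 / y)
    (e₀ := 1 / y) (by simpa using Interlaces.zero_right _ _) hv hqq (one_div_ne_zero hy0) _ ⊥ hm ?_
  have h0 := hMf ⊥ hbot
  rw [hMbot, eq_comm, mul_eq_zero] at h0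
  rw [← h0.resolve_left hq0]
  refine Finset.sum_congr rfl fun t ht => ?_
  have ht := mem_coversAbove.mp ht
  exact ((hstep _ ⊥ t ht (by rw [hG ⊥ t ht]; omega)).1).symm

end HPoly

end UMEL

theorem mainTheorem10 (P : Type u) [PartialOrder P] [BoundedOrder P] [Fintype P]
    [LocallyFiniteOrder P] [DecidableEq P] (hP : UMEL.IsUMELShellable.{u, v} P) :
    UMEL.RealRooted (UMEL.hPoly Pᵒᵈ) ∧
    UMEL.RealRooted (UMEL.chowPoly Pᵒᵈ) ∧
    UMEL.RealRooted (UMEL.augChowPoly Pᵒᵈ) := by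
  obtain ⟨hG, Λ, _, lab, hEL, hU, hM⟩ := hP
  exact ⟨UMEL.hPoly_dual P ▸ UMEL.realRooted_hPoly hG hEL hU hM,
    UMEL.realRooted_chowPoly_dual hG hEL hU hM, UMEL.realRooted_augChowPoly_dual hG hEL hU hM⟩
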